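/- Let $n\ge 3$ and let $\Sigma\subset\{0,1\}^{n\times n}$ be a synchronizing automaton with $n$ states: a set of 0/1 matrices (letters) each of whose rows sums to $1$, such that some finite product of letters equals $e^Te_i$ for some $i$, where $e$ is the all-ones row vector and $e_i$ the $i$-th standard basis row vector. Let $\Sigma^{\le t}$ be the set of products of at most $t$ letters (including the identity matrix). The synchronizing probability function is $$k(t)=\min_{p\in\mathbb R^n_{\ge 0},\ ep^T=1}\ \max_{W\in\Sigma^{\le t},\ 1\le i\le n}(pW)e_i^T ,\qquad t\in\mathbb N,$$ and the triple rendezvous time $T_3$ is the least $t$ such that some matrix in $\Sigma^{\le t}$ has a column with at least three non-zero entries. Then: 1. for every integer $t$ with $1\le t<T_3$ there is an integer $s$ with $0\le s\le n-1$ and $k(t)=\frac{2}{n+s}$; 2. for every integer $s$ with $0\le s\le n-1$, the function $k$ takes the value $\frac{2}{n+s}$ at no more than $\lfloor (n-s)/2\rfloor+1$ consecutive values of $t$, for any block of consecutive values of $t$ that begins before $T_3$; that is, if $t<T_3$ and $k(t)=k(t+1)=\dots=k(t+m-1)=\frac{2}{n+s}$, then $m\le\lfloor (n-s)/2\rfloor+1$.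 -/

import Mathlib

noncomputable section

namespace SyncAutomaton

/-- A (deterministic, complete, finite state) automaton with states `Fin n`, given by its set of
letters: every letter is a 0/1 matrix whose rows sum to one. -/
def IsAutomaton {n : ℕ} (S : Set (Matrix (Fin n) (Fin n) ℝ)) : Prop :=
  ∀ L ∈ S, (∀ i j, L i j = 0 ∨ L i j = 1) ∧ ∀ i, ∑ j, L i j = 1

/-- The products of at most `t` letters; the product of length zero is the identity matrix. -/
def wordsLE {n : ℕ} (S : Set (Matrix (Fin n) (Fin n) ℝ)) (t : ℕ) :
    Set (Matrix (Fin n) (Fin n) ℝ) :=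
  {W | ∃ l : List (Matrix (Fin n) (Fin n) ℝ), (∀ L ∈ l, L ∈ S) ∧ l.length ≤ t ∧ l.prod = W}

/-- Some finite product of letters is `eᵀ eᵢ`: it maps all states to the single state `i`. -/
def IsSynchronizing {n : ℕ} (S : Set (Matrix (Fin n) (Fin n) ℝ)) : Prop :=
  ∃ (t : ℕ) (i : Fin n), Matrix.vecMulVec (1 : Fin n → ℝ) (Pi.single i 1) ∈ wordsLE S t

/-- `max (p W) eᵢᵀ` over the words `W` of length at most `t` and the states `i`: the probability
that Player One wins, when Player Two plays the policy `p`. -/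
def winProb {n : ℕ} (S : Set (Matrix (Fin n) (Fin n) ℝ)) (t : ℕ) (p : Fin n → ℝ) : ℝ :=
  sSup {x | ∃ W ∈ wordsLE S t, ∃ i, x = Matrix.vecMul p W i}

/-- The synchronizing probability function: the minimum of `winProb S t p` over all probability
distributions `p` on the states. -/
def spf {n : ℕ} (S : Set (Matrix (Fin n) (Fin n) ℝ)) (t : ℕ) : ℝ :=
  sInf (winProb S t '' stdSimplex ℝ (Fin n))

/-- The set `A(t)` of reachable vectors: the columns of the words of length at most `t`. -/
def reachable {n : ℕ} (S : Set (Matrix (Fin n) (Fin n) ℝ)) (t : ℕ) : Set (Fin n → ℝ) :=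
  {v | ∃ W ∈ wordsLE S t, ∃ j, v = W.col j}

/-- The number of non-zero entries of a vector. -/
def weight {n : ℕ} (v : Fin n → ℝ) : ℕ :=
  Set.ncard {i | v i ≠ 0}

/-- The triple rendezvous time: the least `t` such that some vector reachable at `t` has weight at
least three. Such a `t` exists for every synchronizing automaton with at least three states. -/
def tripleRendezvousTime {n : ℕ} (S : Set (Matrix (Fin n) (Fin n) ℝ)) : ℕ :=
  sInf {t | ∃ v ∈ reachable S t, 3 ≤ weight v}

end SyncAutomaton

end

/-!
A word `W` of length less than `T₃` is a self-map of the states whose fibres have at most two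
elements, so `k(t)` is the least `c` for which some probability distribution gives mass at most `c`
to every state and to every pair of states merged by a word of length at most `t`. These pairs are
the edges of a graph. By linear programming duality, which is here the König–Ore theorem for the
bipartite double cover of the graph, this `c` is `2 / (2 n - |A|)`, where `A` is the set of states
covered on one side by a maximum matching of the double cover; so `s = n - |A|`.

By complementary slackness all optimal distributions lie in a space of dimension at most
`|A| / 2 + 1`. As long as `k` keeps the value `c`, the spans of the sets of optimal distributions
strictly decrease with `t`: otherwise such a span would be invariant under all letters, hence by
synchronization would contain a point mass, which violates complementary slackness.
-/

namespace SyncAutomaton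

open Finset Module

section Hall

variable {ι α : Type*} [Fintype ι] [DecidableEq α] [Nonempty α]

theorem exists_injOn_of_card_le_card_biUnion_add {N : ι → Finset α} {s : ℕ}
    (hN : ∀ J : Finset ι, #J ≤ #(J.biUnion N) + s) :
    ∃ (A : Finset ι) (g : ι → α), Set.InjOn g A ∧ (∀ i ∈ A, g i ∈ N i) ∧
      Fintype.card ι ≤ #A + s := by
  classical
  -- Hall's theorem applies once every `N i` is enlarged by the same `s` new elements.
  have hall (J : Finset ι) : #J ≤ #(J.biUnion fun i => (N i).disjSum (univ : Finset (Fin s))) := by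
    rcases J.eq_empty_or_nonempty with rfl | ⟨a, ha⟩
    · simp
    have hsub : (J.biUnion N).disjSum (univ : Finset (Fin s)) ⊆
        J.biUnion fun i => (N i).disjSum univ := by
      rintro (j | k) hz
      · simpa using hz
      · simpa using ⟨a, ha⟩
    simpa using (hN J).trans (by simpa [card_disjSum] using card_le_card hsub)
  obtain ⟨f, hf, hfN⟩ := (all_card_le_biUnion_card_iff_exists_injective _).1 hall
  let A : Finset ι := {i | (f i).isLeft}
  let g : ι → α := fun i => (f i).elim id fun _ => Classical.arbitrary α
  have hg : ∀ i ∈ A, f i = Sum.inl (g i) := by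
    intro i hi
    obtain ⟨j, hj⟩ := Sum.isLeft_iff.1 (mem_filter.1 hi).2
    simp [g, hj]
  have hcompl : #Aᶜ ≤ s := by
    have hsub : Aᶜ.image f ⊆ univ.map Function.Embedding.inr := by
      intro z hz
      obtain ⟨i, hi, rfl⟩ := mem_image.1 hz
      obtain ⟨k, hk⟩ := Sum.isRight_iff.1 (show (f i).isRight by simpa [A] using hi)
      simp [hk]
    simpa [card_image_of_injective _ hf] using card_le_card hsub
  refine ⟨A, g, fun i hi j hj hij => hf ?_, fun i hi => ?_, ?_⟩
  · rw [hg i hi, hg j hj, hij]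
  · simpa [hg i hi] using hfN i
  · rw [← card_add_card_compl A]
    exact Nat.add_le_add_left hcompl _

theorem exists_injOn_card_add_card_biUnion_le (N : ι → Finset α) :
    ∃ (A I : Finset ι) (g : ι → α), Set.InjOn g A ∧ (∀ i ∈ A, g i ∈ N i) ∧
      Fintype.card ι + #(I.biUnion N) ≤ #A + #I := by
  classical
  obtain ⟨I, -, hI⟩ := exists_max_image univ
    (fun I : Finset ι => (#I : ℤ) - #(I.biUnion N)) univ_nonempty
  have hI0 : #(I.biUnion N) ≤ #I := by simpa using hI ∅ (mem_univ _)
  have hdef (J : Finset ι) : #J ≤ #(J.biUnion N) + (#I - #(I.biUnion N)) := by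
    have := hI J (mem_univ _)
    omega
  obtain ⟨A, g, hg, hgN, hA⟩ := exists_injOn_of_card_le_card_biUnion_add hdef
  exact ⟨A, I, g, hg, hgN, by omega⟩

end Hall

section LinearAlgebra

variable {𝕜 E V : Type*} [Field 𝕜]

theorem finrank_le_finrank_inf_ker_add_one [AddCommGroup E] [Module 𝕜 E] [FiniteDimensional 𝕜 E]
    (W : Submodule 𝕜 E) (φ : Dual 𝕜 E) :
    finrank 𝕜 W ≤ finrank 𝕜 ↥(W ⊓ LinearMap.ker φ) + 1 := by
  have h1 := Submodule.finrank_sup_add_finrank_inf_eq W (LinearMap.ker φ)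
  have h2 := Submodule.finrank_le (W ⊔ LinearMap.ker φ)
  have h3 := LinearMap.finrank_range_add_finrank_ker φ
  have h4 := Submodule.finrank_le (LinearMap.range φ)
  rw [finrank_self] at h4
  omega

theorem add_finrank_le_of_strictAnti [AddCommGroup E] [Module 𝕜 E] [FiniteDimensional 𝕜 E]
    {W : ℕ → Submodule 𝕜 E} {m : ℕ} (hW : ∀ j < m, W (j + 1) < W j) :
    m + finrank 𝕜 (W m) ≤ finrank 𝕜 (W 0) := by
  induction m with
  | zero => simp
  | succ m ih =>
    have h1 := ih fun j hj => hW j (by omega)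
    have h2 := Submodule.finrank_lt_finrank_of_lt (hW m (by omega))
    omega

variable [Finite V]

theorem exists_finset_card_eq_finrank_forall_exists_mem_eq (K : Submodule 𝕜 (V → 𝕜)) :
    ∃ B : Finset V, #B = finrank 𝕜 K ∧ ∀ z : V → 𝕜, ∃ y ∈ K, ∀ i ∈ B, y i = z i := by
  classical
  cases nonempty_fintype V
  let e (i : V) : Dual 𝕜 K := (LinearMap.proj i).domRestrict K
  have hspan : Submodule.span 𝕜 (Set.range e) = ⊤ := by
    refine eq_top_iff.2 fun φ _ => mem_span_of_iInf_ker_le_ker fun y hy => ?_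
    have hy0 : y = 0 := Subtype.ext (funext fun i => (Submodule.mem_iInf _).1 hy i)
    exact hy0 ▸ zero_mem _
  obtain ⟨b, -, -, hb, hli⟩ := exists_linearIndepOn_extension (linearIndepOn_empty 𝕜 e)
    (Set.empty_subset Set.univ)
  let β : Basis b 𝕜 (Dual 𝕜 K) := .mk hli <| by
    rwa [← hspan, Submodule.span_le, ← Set.image_univ, ← Set.image_eq_range]
  refine ⟨b.toFinset, ?_, fun z => ?_⟩
  · rw [← Subspace.dual_finrank_eq, finrank_eq_card_basis β, Set.toFinset_card]
  · let y : K := (evalEquiv 𝕜 K).symm (β.constr 𝕜 fun i => z i)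
    refine ⟨y, y.2, fun i hi => ?_⟩
    have hβ : β ⟨i, Set.mem_toFinset.1 hi⟩ = e i := Basis.mk_apply ..
    calc (y : V → 𝕜) i = e i y := rfl
      _ = β.constr 𝕜 (fun i => z i) (e i) := apply_evalEquiv_symm_apply ..
      _ = z i := by rw [← hβ, Basis.constr_basis]

theorem two_mul_finrank_le_card_of_neg [NeZero (2 : 𝕜)] {K : Submodule 𝕜 (V → 𝕜)}
    {A : Finset V} {g : V → V} (hg : Set.InjOn g A) (hneg : ∀ y ∈ K, ∀ i ∈ A, y i + y (g i) = 0)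
    (hzero : ∀ y ∈ K, ∀ i ∉ A, y i = 0) : 2 * finrank 𝕜 K ≤ #A := by
  classical
  obtain ⟨B, hB, hsurj⟩ := exists_finset_card_eq_finrank_forall_exists_mem_eq K
  obtain ⟨y, hy, hyB⟩ := hsurj fun _ => 1
  have hBA : B ⊆ A := fun i hi => not_imp_comm.1 (hzero y hy i) (by simp [hyB i hi])
  have hyg : ∀ i ∈ B, y (g i) = -1 := fun i hi => by
    linear_combination hneg y hy i (hBA hi) - hyB i hi
  have hgBA : B.image g ⊆ A := image_subset_iff.2 fun i hi =>
    not_imp_comm.1 (hzero y hy (g i)) (by simp [hyg i hi])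
  have hdisj : Disjoint B (B.image g) := by
    refine disjoint_right.2 fun j hj hjB => ?_
    obtain ⟨i, hi, rfl⟩ := mem_image.1 hj
    refine two_ne_zero (α := 𝕜) ?_
    linear_combination hyg i hi - hyB (g i) hjB
  calc 2 * finrank 𝕜 K = #(B ∪ B.image g) := by
        rw [card_union_of_disjoint hdisj, card_image_of_injOn (hg.mono (coe_subset.2 hBA)), hB,
          two_mul]
    _ ≤ #A := card_le_card (union_subset hBA hgBA)

end LinearAlgebra

section Graph

variable {𝕜 V : Type*} {G : SimpleGraph V} {A : Finset V} {g : V → V} {c : 𝕜}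

/-- An injection `g` of the set of vertices `A` into the vertices that moves every vertex of `A`
along an edge: a matching of size `#A` in the bipartite double cover of `G`. Only the values of `g`
on `A` matter. -/
structure IsDoubleCoverMatching (G : SimpleGraph V) (A : Finset V) (g : V → V) : Prop where
  injOn : Set.InjOn g A
  adj : ∀ i ∈ A, G.Adj i (g i)

theorem isDoubleCoverMatching_singleton {i j : V} (hij : G.Adj i j) :
    IsDoubleCoverMatching G {i} fun _ => j where
  injOn := by simp
  adj := by simpa using hij

variable [Fintype V] [Field 𝕜]

section TightSpace

/-- The functions satisfying `x i + x (g i) = c` for `i ∈ A` and `x i = c` for `i ∉ A`, with `c`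
replaced by `c * ∑ k, x k` so that these constraints become linear. -/
def tightSpace (A : Finset V) (g : V → V) (c : 𝕜) : Submodule 𝕜 (V → 𝕜) where
  carrier := {x | (∀ i ∈ A, x i + x (g i) = c * ∑ k, x k) ∧ ∀ i ∉ A, x i = c * ∑ k, x k}
  add_mem' {x y} hx hy := by
    simp only [Set.mem_ofPred_eq, Pi.add_apply, sum_add_distrib]
    exact ⟨fun i hi => by linear_combination hx.1 i hi + hy.1 i hi,
      fun i hi => by linear_combination hx.2 i hi + hy.2 i hi⟩
  zero_mem' := by simp
  smul_mem' a x hx := by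
    simp only [Set.mem_ofPred_eq, Pi.smul_apply, smul_eq_mul, ← mul_sum]
    exact ⟨fun i hi => by linear_combination a * hx.1 i hi,
      fun i hi => by linear_combination a * hx.2 i hi⟩

theorem finrank_tightSpace_le [NeZero (2 : 𝕜)] (hg : Set.InjOn g A) (c : 𝕜) :
    finrank 𝕜 (tightSpace A g c) ≤ #A / 2 + 1 := by
  let σ : Dual 𝕜 (V → 𝕜) := ∑ i, LinearMap.proj i
  have hσ : ∀ y ∈ tightSpace A g c ⊓ LinearMap.ker σ, ∑ k, y k = 0 := fun y hy => by
    simpa [σ] using hy.2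
  have hhalf : 2 * finrank 𝕜 ↥(tightSpace A g c ⊓ LinearMap.ker σ) ≤ #A :=
    two_mul_finrank_le_card_of_neg hg
      (fun y hy i hi => by simpa [hσ y hy] using hy.1.1 i hi)
      (fun y hy i hi => by simpa [hσ y hy] using hy.1.2 i hi)
  have hσ1 := finrank_le_finrank_inf_ker_add_one (tightSpace A g c) σ
  omega

theorem IsDoubleCoverMatching.single_notMem_tightSpace [DecidableEq V]
    (h : IsDoubleCoverMatching G A g) (hc : c ≠ 1) (k : V) :
    Pi.single k 1 ∉ tightSpace A g c := by
  intro hk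
  refine hc (Eq.symm ?_)
  by_cases hkA : k ∈ A
  · simpa [(h.adj k hkA).ne'] using hk.1 k hkA
  · simpa using hk.2 k hkA

end TightSpace

theorem mul_sub_two_mul_sum_eq_of_injOn [DecidableEq V] (hg : Set.InjOn g A) (x : V → 𝕜) (c : 𝕜) :
    (2 * Fintype.card V - #A) * c - 2 * ∑ i, x i =
      ∑ i ∈ A, (c - (x i + x (g i))) + (∑ i ∈ Aᶜ, (c - x i) + ∑ i ∈ (A.image g)ᶜ, (c - x i)) := by
  have hA := sum_add_sum_compl A x
  have hgA := sum_add_sum_compl (A.image g) x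
  rw [sum_image hg] at hgA
  simp only [sum_sub_distrib, sum_add_distrib, sum_const, card_compl, card_image_of_injOn hg,
    nsmul_eq_mul, Nat.cast_sub A.card_le_univ]
  linear_combination hA + hgA

variable [LinearOrder 𝕜]

/-- The probability distributions on the vertices in which every vertex and every edge has
probability at most `c`; after scaling by `1 / c` these are the fractional stable sets of `G`. -/
def cappedDistributions (G : SimpleGraph V) (c : 𝕜) : Set (V → 𝕜) :=
  {p | p ∈ stdSimplex 𝕜 V ∧ (∀ i, p i ≤ c) ∧ ∀ i j, G.Adj i j → p i + p j ≤ c}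

theorem cappedDistributions_mono (G : SimpleGraph V) :
    Monotone (cappedDistributions (𝕜 := 𝕜) G) :=
  fun _ _ hcd _ hp =>
    ⟨hp.1, fun i => (hp.2.1 i).trans hcd, fun i j hij => (hp.2.2 i j hij).trans hcd⟩

variable [IsStrictOrderedRing 𝕜]

theorem nonneg_of_mem_cappedDistributions {p : V → 𝕜} (hp : p ∈ cappedDistributions G c) :
    0 ≤ c := by
  obtain ⟨i, -, -⟩ := exists_ne_zero_of_sum_ne_zero (hp.1.2.trans_ne one_ne_zero)
  exact (hp.1.1 i).trans (hp.2.1 i)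

theorem sum_le_of_isClique {p : V → 𝕜} (hp : p ∈ cappedDistributions G c) {F : Finset V}
    (hF : G.IsClique F) (hcard : #F ≤ 2) : ∑ i ∈ F, p i ≤ c := by
  classical
  interval_cases hF2 : #F
  · simpa [card_eq_zero.1 hF2] using nonneg_of_mem_cappedDistributions hp
  · obtain ⟨i, rfl⟩ := card_eq_one.1 hF2
    simpa using hp.2.1 i
  · obtain ⟨i, j, hij, rfl⟩ := card_eq_two.1 hF2
    rw [sum_pair hij]
    exact hp.2.2 i j (hF (by simp) (by simp) hij)

theorem IsDoubleCoverMatching.two_le_mul (h : IsDoubleCoverMatching G A g) {p : V → 𝕜}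
    (hp : p ∈ cappedDistributions G c) : 2 ≤ (2 * Fintype.card V - #A) * c := by
  classical
  have hslack := mul_sub_two_mul_sum_eq_of_injOn h.injOn p c
  have hedge : 0 ≤ ∑ i ∈ A, (c - (p i + p (g i))) :=
    sum_nonneg fun i hi => sub_nonneg.2 (hp.2.2 i _ (h.adj i hi))
  have hvertex (B : Finset V) : 0 ≤ ∑ i ∈ B, (c - p i) :=
    sum_nonneg fun i _ => sub_nonneg.2 (hp.2.1 i)
  rw [hp.1.2] at hslack
  linarith [hvertex Aᶜ, hvertex (A.image g)ᶜ]

theorem IsDoubleCoverMatching.mem_tightSpace (h : IsDoubleCoverMatching G A g) {p : V → 𝕜}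
    (hp : p ∈ cappedDistributions G c) (hc : (2 * Fintype.card V - #A) * c = 2) :
    p ∈ tightSpace A g c := by
  classical
  have hedge : ∀ i ∈ A, 0 ≤ c - (p i + p (g i)) := fun i hi =>
    sub_nonneg.2 (hp.2.2 i _ (h.adj i hi))
  have hvertex (i : V) : 0 ≤ c - p i := sub_nonneg.2 (hp.2.1 i)
  have hvertices (B : Finset V) : 0 ≤ ∑ i ∈ B, (c - p i) := sum_nonneg fun i _ => hvertex i
  have hslack := mul_sub_two_mul_sum_eq_of_injOn h.injOn p c
  rw [hp.1.2, hc, mul_one, sub_self, eq_comm,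
    add_eq_zero_iff_of_nonneg (sum_nonneg hedge) (add_nonneg (hvertices _) (hvertices _)),
    add_eq_zero_iff_of_nonneg (hvertices _) (hvertices _), sum_eq_zero_iff_of_nonneg hedge,
    sum_eq_zero_iff_of_nonneg fun i _ => hvertex i] at hslack
  refine ⟨fun i hi => ?_, fun i hi => ?_⟩
  · linear_combination -hslack.1 i hi - c * hp.1.2
  · linear_combination -hslack.2.1 i (mem_compl.2 hi) - c * hp.1.2

theorem cappedDistributions_nonempty_of_weights {w : V → 𝕜} (hw0 : ∀ i, 0 ≤ w i)
    (hw : ∀ i, w i ≤ c) (hww : ∀ i j, G.Adj i j → w i + w j ≤ c) (hpos : 0 < ∑ i, w i) :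
    (cappedDistributions G (c / ∑ i, w i)).Nonempty := by
  refine ⟨fun i => w i / ∑ i, w i, ⟨fun i => div_nonneg (hw0 i) hpos.le, ?_⟩, fun i => ?_,
    fun i j hij => ?_⟩
  · rw [← sum_div, div_self hpos.ne']
  · exact div_le_div_of_nonneg_right (hw i) hpos.le
  · rw [← add_div]
    exact div_le_div_of_nonneg_right (hww i j hij) hpos.le

theorem cappedDistributions_nonempty_of_card_biUnion_neighborFinset [Nonempty V] [DecidableEq V]
    [DecidableRel G.Adj] (I : Finset V) :
    (cappedDistributions G
      (2 / (Fintype.card V + #I - #(I.biUnion (G.neighborFinset ·)) : 𝕜))).Nonempty := by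
  set N := I.biUnion (G.neighborFinset ·)
  let w : V → 𝕜 := fun i => 1 + (if i ∈ I then 1 else 0) - if i ∈ N then 1 else 0
  have hsum : ∑ i, w i = Fintype.card V + #I - #N := by
    simp [w, sum_sub_distrib, sum_add_distrib]
  have hpos : 0 < ∑ i, w i := by
    have hlt : #N < Fintype.card V + #I := by
      rcases I.eq_empty_or_nonempty with rfl | hI
      · simpa [N] using Fintype.card_pos
      · linarith [hI.card_pos, N.card_le_univ]
    rw [hsum, sub_pos]
    exact_mod_cast hlt
  rw [← hsum]
  refine cappedDistributions_nonempty_of_weights (fun i => ?_) (fun i => ?_)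
    (fun i j hij => ?_) hpos
  · dsimp only [w]
    split_ifs <;> norm_num
  · dsimp only [w]
    split_ifs <;> norm_num
  · have hj : i ∈ I → j ∈ N := fun hi => by simpa [N] using ⟨i, hi, hij⟩
    have hi : j ∈ I → i ∈ N := fun hj => by simpa [N] using ⟨j, hj, hij.symm⟩
    dsimp only [w]
    split_ifs <;> first | (exfalso; tauto) | norm_num

theorem exists_isDoubleCoverMatching_isLeast (𝕜 : Type*) [Field 𝕜] [LinearOrder 𝕜]
    [IsStrictOrderedRing 𝕜] [Nonempty V] (G : SimpleGraph V) :
    ∃ A g, IsDoubleCoverMatching G A g ∧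
      IsLeast {c : 𝕜 | (cappedDistributions G c).Nonempty} (2 / (2 * Fintype.card V - #A)) := by
  classical
  obtain ⟨A, I, g, hg, hgG, hAI⟩ := exists_injOn_card_add_card_biUnion_le (G.neighborFinset ·)
  have h : IsDoubleCoverMatching G A g := ⟨hg, fun i hi => by simpa using hgG i hi⟩
  have hA : (#A : 𝕜) ≤ Fintype.card V := mod_cast A.card_le_univ
  have hV : (0 : 𝕜) < Fintype.card V := mod_cast Fintype.card_pos
  refine ⟨A, g, h, ?_, fun c ⟨p, hp⟩ => ?_⟩
  · refine (cappedDistributions_nonempty_of_card_biUnion_neighborFinset I).mono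
      (cappedDistributions_mono G ?_)
    have hAI' : (Fintype.card V + #(I.biUnion (G.neighborFinset ·)) : 𝕜) ≤ #A + #I := mod_cast hAI
    exact div_le_div_of_nonneg_left zero_le_two (by linarith) (by linarith)
  · rw [div_le_iff₀' (by linarith)]
    exact h.two_le_mul hp

end Graph

section FunMatrix

variable {V R : Type*} [DecidableEq V] [Semiring R]

/-- The 0/1 matrix of a self-map `f`: it has a one at `(i, f i)` for every `i`. The letters of an
automaton are handled through the self-maps of the states they induce. -/
def funMatrix (f : V → V) : Matrix V V R :=
  (1 : Matrix V V R).submatrix f id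

theorem funMatrix_apply (f : V → V) (i j : V) :
    (funMatrix f i j : R) = if f i = j then 1 else 0 := rfl

theorem funMatrix_id : (funMatrix id : Matrix V V R) = 1 := rfl

variable [Fintype V]

theorem funMatrix_mul_funMatrix (f g : V → V) :
    (funMatrix f * funMatrix g : Matrix V V R) = funMatrix (g ∘ f) := by
  ext i j
  simp only [Matrix.mul_apply, funMatrix_apply, ite_mul, one_mul, zero_mul, sum_ite_eq, mem_univ,
    if_true, Function.comp_apply]

theorem vecMul_funMatrix_apply (p : V → R) (f : V → V) (j : V) :
    Matrix.vecMul p (funMatrix f) j = ∑ i with f i = j, p i := by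
  simp [Matrix.vecMul, dotProduct, funMatrix_apply, sum_filter]

theorem vecMul_funMatrix_mem_stdSimplex [PartialOrder R] [IsOrderedRing R] {p : V → R}
    (hp : p ∈ stdSimplex R V) (f : V → V) : Matrix.vecMul p (funMatrix f) ∈ stdSimplex R V := by
  refine ⟨fun j => ?_, ?_⟩
  · rw [vecMul_funMatrix_apply]
    exact sum_nonneg fun i _ => hp.1 i
  · simp_rw [vecMul_funMatrix_apply]
    rw [sum_fiberwise]
    exact hp.2

theorem exists_eq_funMatrix [CharZero R] {L : Matrix V V R} (h01 : ∀ i j, L i j = 0 ∨ L i j = 1)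
    (hrow : ∀ i, ∑ j, L i j = 1) : ∃ f, L = funMatrix f := by
  classical
  have hL (i j) : L i j = if L i j = 1 then 1 else 0 := by
    rcases h01 i j with h | h <;> simp [h]
  have hcard (i) : #{j | L i j = 1} = 1 := by
    have := hrow i
    rw [sum_congr rfl fun j _ => hL i j, sum_boole] at this
    exact_mod_cast this
  choose f hf using fun i => card_eq_one.1 (hcard i)
  refine ⟨f, Matrix.ext fun i j => ?_⟩
  have hij : L i j = 1 ↔ f i = j := by simpa [eq_comm] using Finset.ext_iff.1 (hf i) j
  rw [hL, funMatrix_apply, if_congr hij rfl rfl]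

end FunMatrix

variable {n : ℕ} {S : Set (Matrix (Fin n) (Fin n) ℝ)} {t : ℕ}

section Words

theorem one_mem_wordsLE (t : ℕ) : 1 ∈ wordsLE S t :=
  ⟨[], by simp, by simp, by simp⟩

theorem wordsLE_mono (S : Set (Matrix (Fin n) (Fin n) ℝ)) : Monotone (wordsLE S) :=
  fun _ _ htu _ ⟨l, hl, hlen, hW⟩ => ⟨l, hl, hlen.trans htu, hW⟩

theorem mul_mem_wordsLE {L W : Matrix (Fin n) (Fin n) ℝ} (hL : L ∈ S) (hW : W ∈ wordsLE S t) :
    L * W ∈ wordsLE S (t + 1) := by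
  obtain ⟨l, hl, hlen, rfl⟩ := hW
  exact ⟨L :: l, List.forall_mem_cons.2 ⟨hL, hl⟩, Nat.succ_le_succ hlen, List.prod_cons⟩

theorem mem_wordsLE_one {L : Matrix (Fin n) (Fin n) ℝ} (hL : L ∈ S) : L ∈ wordsLE S 1 :=
  mul_one L ▸ mul_mem_wordsLE hL (one_mem_wordsLE 0)

theorem wordsLE_subset_closure : wordsLE S t ⊆ Submonoid.closure S := by
  rintro _ ⟨l, hl, -, rfl⟩
  exact list_prod_mem fun L hL => Submonoid.subset_closure (hl L hL)

theorem IsAutomaton.exists_funMatrix_of_mem (hS : IsAutomaton S) {L : Matrix (Fin n) (Fin n) ℝ}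
    (hL : L ∈ S) : ∃ f, L = funMatrix f :=
  exists_eq_funMatrix (hS L hL).1 (hS L hL).2

theorem exists_prop_and_eq_funMatrix_of_mem_wordsLE {P : (Fin n → Fin n) → Prop} (hid : P id)
    (hcomp : ∀ f g, P f → P g → P (g ∘ f)) (hletter : ∀ L ∈ S, ∃ f, P f ∧ L = funMatrix f)
    {W : Matrix (Fin n) (Fin n) ℝ} (hW : W ∈ wordsLE S t) : ∃ f, P f ∧ W = funMatrix f := by
  replace hW := wordsLE_subset_closure hW
  induction hW using Submonoid.closure_induction with
  | mem L hL => exact hletter L hL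
  | one => exact ⟨id, hid, funMatrix_id.symm⟩
  | mul W W' _ _ ih ih' =>
    obtain ⟨f, hf, rfl⟩ := ih
    obtain ⟨g, hg, rfl⟩ := ih'
    exact ⟨g ∘ f, hcomp f g hf hg, funMatrix_mul_funMatrix f g⟩

theorem IsAutomaton.exists_funMatrix_of_mem_wordsLE (hS : IsAutomaton S)
    {W : Matrix (Fin n) (Fin n) ℝ} (hW : W ∈ wordsLE S t) : ∃ f, W = funMatrix f := by
  simpa using exists_prop_and_eq_funMatrix_of_mem_wordsLE (P := fun _ => True) trivial
    (fun _ _ _ _ => trivial) (fun L hL => by simpa using hS.exists_funMatrix_of_mem hL) hW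

theorem card_fiber_le_two_of_lt_tripleRendezvousTime (ht : t < tripleRendezvousTime S)
    {f : Fin n → Fin n} (hf : funMatrix f ∈ wordsLE S t) (k : Fin n) : #{i | f i = k} ≤ 2 := by
  by_contra! h
  refine Nat.notMem_of_lt_sInf ht ⟨_, ⟨_, hf, k, rfl⟩, ?_⟩
  have hsupp : {i | (funMatrix f).col k i ≠ (0 : ℝ)} = ↑({i | f i = k} : Finset (Fin n)) := by
    ext i
    simp [funMatrix_apply]
  rw [weight, hsupp, Set.ncard_coe_finset]
  exact h

end Words

section Feasible

/-- The policies of Player Two against which no word of length at most `t` wins with probability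
more than `c`. -/
def feasible (S : Set (Matrix (Fin n) (Fin n) ℝ)) (t : ℕ) (c : ℝ) : Set (Fin n → ℝ) :=
  {p | p ∈ stdSimplex ℝ (Fin n) ∧ ∀ W ∈ wordsLE S t, ∀ i, Matrix.vecMul p W i ≤ c}

theorem feasible_antitone (S : Set (Matrix (Fin n) (Fin n) ℝ)) (c : ℝ) :
    Antitone fun t => feasible S t c :=
  fun _ _ htu _ hp => ⟨hp.1, fun W hW => hp.2 W (wordsLE_mono S htu hW)⟩

theorem IsAutomaton.vecMul_mem_feasible (hS : IsAutomaton S) {c : ℝ} {p : Fin n → ℝ}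
    (hp : p ∈ feasible S (t + 1) c) {L : Matrix (Fin n) (Fin n) ℝ} (hL : L ∈ S) :
    Matrix.vecMul p L ∈ feasible S t c := by
  obtain ⟨f, rfl⟩ := hS.exists_funMatrix_of_mem hL
  refine ⟨vecMul_funMatrix_mem_stdSimplex hp.1 f, fun W hW i => ?_⟩
  rw [Matrix.vecMul_vecMul]
  exact hp.2 _ (mul_mem_wordsLE hL hW) i

theorem IsAutomaton.vecMul_le_winProb (hS : IsAutomaton S) {p : Fin n → ℝ}
    (hp : p ∈ stdSimplex ℝ (Fin n)) {W : Matrix (Fin n) (Fin n) ℝ} (hW : W ∈ wordsLE S t)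
    (i : Fin n) : Matrix.vecMul p W i ≤ winProb S t p := by
  refine le_csSup ⟨1, ?_⟩ ⟨W, hW, i, rfl⟩
  rintro _ ⟨V, hV, j, rfl⟩
  obtain ⟨f, rfl⟩ := hS.exists_funMatrix_of_mem_wordsLE hV
  exact (mem_Icc_of_mem_stdSimplex (vecMul_funMatrix_mem_stdSimplex hp f) j).2

variable [Nonempty (Fin n)]

theorem setOf_vecMul_nonempty (S : Set (Matrix (Fin n) (Fin n) ℝ)) (t : ℕ) (p : Fin n → ℝ) :
    {x | ∃ W ∈ wordsLE S t, ∃ i, x = Matrix.vecMul p W i}.Nonempty :=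
  ⟨_, 1, one_mem_wordsLE t, Classical.arbitrary _, rfl⟩

theorem IsAutomaton.winProb_le_iff_mem_feasible (hS : IsAutomaton S) {c : ℝ} {p : Fin n → ℝ}
    (hp : p ∈ stdSimplex ℝ (Fin n)) : winProb S t p ≤ c ↔ p ∈ feasible S t c := by
  refine ⟨fun h => ⟨hp, fun W hW i => (hS.vecMul_le_winProb hp hW i).trans h⟩, fun h => ?_⟩
  refine csSup_le (setOf_vecMul_nonempty S t p) ?_
  rintro _ ⟨W, hW, i, rfl⟩
  exact h.2 W hW i

theorem IsAutomaton.lowerSemicontinuousOn_winProb (hS : IsAutomaton S) (t : ℕ) :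
    LowerSemicontinuousOn (winProb S t) (stdSimplex ℝ (Fin n)) := by
  intro p _ y hy
  obtain ⟨_, ⟨W, hW, i, rfl⟩, hlt⟩ := exists_lt_of_lt_csSup (setOf_vecMul_nonempty S t p) hy
  have hcont : Continuous fun q : Fin n → ℝ => Matrix.vecMul q W i := by fun_prop
  filter_upwards [self_mem_nhdsWithin, nhdsWithin_le_nhds
    (hcont.continuousAt.eventually (lt_mem_nhds hlt))] with q hq hlt'
  exact hlt'.trans_le (hS.vecMul_le_winProb hq hW i)

theorem IsAutomaton.isLeast_spf (hS : IsAutomaton S) (t : ℕ) :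
    IsLeast {c | (feasible S t c).Nonempty} (spf S t) := by
  obtain ⟨p, hp, hmin⟩ := (hS.lowerSemicontinuousOn_winProb t).exists_isMinOn
    ⟨_, single_mem_stdSimplex ℝ (Classical.arbitrary (Fin n))⟩ (isCompact_stdSimplex ℝ (Fin n))
  have hspf : spf S t = winProb S t p :=
    IsLeast.csInf_eq ⟨Set.mem_image_of_mem _ hp, Set.forall_mem_image.2 fun q hq => hmin hq⟩
  refine ⟨⟨p, (hS.winProb_le_iff_mem_feasible hp).1 hspf.ge⟩, fun c ⟨q, hq⟩ => ?_⟩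
  exact hspf ▸ (hmin hq.1).trans ((hS.winProb_le_iff_mem_feasible hq.1).2 hq)

end Feasible

section MergeGraph

/-- The graph joining two states when some word of length at most `t` maps them to the same
state. -/
def mergeGraph (S : Set (Matrix (Fin n) (Fin n) ℝ)) (t : ℕ) : SimpleGraph (Fin n) where
  Adj i j := i ≠ j ∧ ∃ f : Fin n → Fin n, funMatrix f ∈ wordsLE S t ∧ f i = f j
  symm := ⟨fun _ _ ⟨hij, f, hf, h⟩ => ⟨hij.symm, f, hf, h.symm⟩⟩
  loopless := ⟨fun _ h => h.1 rfl⟩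

theorem IsAutomaton.feasible_eq_cappedDistributions (hS : IsAutomaton S)
    (ht : t < tripleRendezvousTime S) (c : ℝ) :
    feasible S t c = cappedDistributions (mergeGraph S t) c := by
  ext p
  refine ⟨fun hp => ⟨hp.1, fun i => ?_, ?_⟩, fun hp => ⟨hp.1, fun W hW k => ?_⟩⟩
  · simpa using hp.2 1 (one_mem_wordsLE t) i
  · rintro i j ⟨hij, f, hf, hfij⟩
    calc p i + p j = ∑ k ∈ {i, j}, p k := (sum_pair hij).symm
      _ ≤ ∑ k with f k = f j, p k := sum_le_sum_of_subset_of_nonneg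
          (by simp [insert_subset_iff, hfij]) fun k _ _ => hp.1.1 k
      _ ≤ c := vecMul_funMatrix_apply p f _ ▸ hp.2 _ hf _
  · obtain ⟨f, rfl⟩ := hS.exists_funMatrix_of_mem_wordsLE hW
    rw [vecMul_funMatrix_apply]
    refine sum_le_of_isClique hp (fun i hi j hj hij => ⟨hij, f, hW, ?_⟩)
      (card_fiber_le_two_of_lt_tripleRendezvousTime ht hW k)
    exact (mem_filter.1 hi).2.trans (mem_filter.1 hj).2.symm

theorem IsAutomaton.exists_letter_not_injective [Nontrivial (Fin n)] (hS : IsAutomaton S)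
    (hsync : IsSynchronizing S) : ∃ f : Fin n → Fin n, funMatrix f ∈ S ∧ ¬ f.Injective := by
  by_contra! h
  obtain ⟨t, k, hW⟩ := hsync
  have hletter : ∀ L ∈ S, ∃ f : Fin n → Fin n, f.Injective ∧ L = funMatrix f := by
    intro L hL
    obtain ⟨f, rfl⟩ := hS.exists_funMatrix_of_mem hL
    exact ⟨f, h f hL, rfl⟩
  obtain ⟨f, hf, hfk⟩ := exists_prop_and_eq_funMatrix_of_mem_wordsLE Function.injective_id
    (fun f g hf hg => hg.comp hf) hletter hW
  have hconst (i : Fin n) : f i = k := by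
    simpa [Matrix.vecMulVec_apply, funMatrix_apply] using congrFun₂ hfk i k
  obtain ⟨i, j, hij⟩ := exists_pair_ne (Fin n)
  exact hij (hf ((hconst i).trans (hconst j).symm))

theorem IsAutomaton.exists_mergeGraph_adj [Nontrivial (Fin n)] (hS : IsAutomaton S)
    (hsync : IsSynchronizing S) (ht : 1 ≤ t) : ∃ i j, (mergeGraph S t).Adj i j := by
  obtain ⟨f, hf, hinj⟩ := hS.exists_letter_not_injective hsync
  obtain ⟨i, j, hfij, hij⟩ := Function.not_injective_iff.1 hinj
  exact ⟨i, j, hij, f, wordsLE_mono S ht (mem_wordsLE_one hf), hfij⟩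

end MergeGraph

section Span

theorem exists_single_mem_of_invariant (hsync : IsSynchronizing S)
    {M : Submodule ℝ (Fin n → ℝ)} (hM : ∀ L ∈ S, ∀ x ∈ M, Matrix.vecMul x L ∈ M)
    {p : Fin n → ℝ} (hp : p ∈ M) (hp1 : ∑ i, p i = 1) : ∃ i, Pi.single i 1 ∈ M := by
  obtain ⟨t, i, hW⟩ := hsync
  have hinv : ∀ W ∈ Submonoid.closure S, ∀ x ∈ M, Matrix.vecMul x W ∈ M := by
    intro W hW
    induction hW using Submonoid.closure_induction with
    | mem L hL => exact hM L hL
    | one => simp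
    | mul W W' _ _ ih ih' => exact fun x hx => Matrix.vecMul_vecMul x W W' ▸ ih' _ (ih x hx)
  have hpW := hinv _ (wordsLE_subset_closure hW) p hp
  rw [Matrix.vecMul_vecMulVec, dotProduct_one, hp1, one_smul] at hpW
  exact ⟨i, hpW⟩

theorem IsAutomaton.vecMul_mem_span_feasible (hS : IsAutomaton S) {c : ℝ}
    {L : Matrix (Fin n) (Fin n) ℝ} (hL : L ∈ S) {x : Fin n → ℝ}
    (hx : x ∈ Submodule.span ℝ (feasible S (t + 1) c)) :
    Matrix.vecMul x L ∈ Submodule.span ℝ (feasible S t c) := by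
  have hle : Submodule.span ℝ (feasible S (t + 1) c) ≤
      (Submodule.span ℝ (feasible S t c)).comap L.vecMulLinear :=
    Submodule.span_le.2 fun p hp => Submodule.subset_span (hS.vecMul_mem_feasible hp hL)
  exact hle hx

theorem IsAutomaton.span_feasible_succ_lt (hS : IsAutomaton S) (hsync : IsSynchronizing S) {c : ℝ}
    (hne : (feasible S t c).Nonempty)
    (hsingle : ∀ i, Pi.single i 1 ∉ Submodule.span ℝ (feasible S t c)) :
    Submodule.span ℝ (feasible S (t + 1) c) < Submodule.span ℝ (feasible S t c) := by
  refine lt_of_le_of_ne (Submodule.span_mono (feasible_antitone S c t.le_succ)) fun heq => ?_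
  obtain ⟨p, hp⟩ := hne
  obtain ⟨i, hi⟩ := exists_single_mem_of_invariant hsync
    (fun L hL x hx => hS.vecMul_mem_span_feasible hL (heq ▸ hx)) (Submodule.subset_span hp) hp.1.2
  exact hsingle i hi

theorem IsAutomaton.le_finrank_span_feasible (hS : IsAutomaton S) (hsync : IsSynchronizing S)
    {m : ℕ} {c : ℝ} (hne : ∀ j < m, (feasible S (t + j) c).Nonempty)
    (hsingle : ∀ i, Pi.single i 1 ∉ Submodule.span ℝ (feasible S t c)) :
    m ≤ finrank ℝ (Submodule.span ℝ (feasible S t c)) := by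
  refine (Nat.le_add_right m _).trans (add_finrank_le_of_strictAnti
    (W := fun j => Submodule.span ℝ (feasible S (t + j) c)) fun j hj => ?_)
  refine hS.span_feasible_succ_lt hsync (hne j hj) fun i hi => hsingle i ?_
  exact Submodule.span_mono (feasible_antitone S c (Nat.le_add_right t j)) hi

end Span

section SpfValues

theorem IsAutomaton.exists_isDoubleCoverMatching_spf_eq [Nonempty (Fin n)] (hS : IsAutomaton S)
    (ht : t < tripleRendezvousTime S) :
    ∃ A g, IsDoubleCoverMatching (mergeGraph S t) A g ∧ spf S t = 2 / (2 * n - #A) := by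
  obtain ⟨A, g, h, hleast⟩ := exists_isDoubleCoverMatching_isLeast ℝ (mergeGraph S t)
  simp_rw [← hS.feasible_eq_cappedDistributions ht, Fintype.card_fin] at hleast
  exact ⟨A, g, h, (hS.isLeast_spf t).unique hleast⟩

theorem IsAutomaton.two_le_two_mul_sub_one_mul_spf [Nontrivial (Fin n)] (hS : IsAutomaton S)
    (hsync : IsSynchronizing S) (ht1 : 1 ≤ t) (ht : t < tripleRendezvousTime S) :
    2 ≤ (2 * n - 1) * spf S t := by
  obtain ⟨i, j, hij⟩ := hS.exists_mergeGraph_adj hsync ht1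
  obtain ⟨p, hp⟩ := (hS.isLeast_spf t).1
  rw [hS.feasible_eq_cappedDistributions ht] at hp
  simpa using (isDoubleCoverMatching_singleton hij).two_le_mul hp

theorem IsAutomaton.exists_spf_eq [Nontrivial (Fin n)] (hS : IsAutomaton S)
    (hsync : IsSynchronizing S) (ht1 : 1 ≤ t) (ht : t < tripleRendezvousTime S) :
    ∃ s : ℕ, s ≤ n - 1 ∧ spf S t = 2 / ((n : ℝ) + s) := by
  obtain ⟨A, g, -, hspf⟩ := hS.exists_isDoubleCoverMatching_spf_eq ht
  have hA : #A ≤ n := A.card_le_univ.trans_eq (Fintype.card_fin n)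
  have hdenom : (2 * n - #A : ℝ) = n + (n - #A : ℕ) := by
    push_cast [hA]
    ring
  have hn : 0 < n := Fin.pos_iff_nonempty.2 inferInstance
  have hpos : (0 : ℝ) < n + (n - #A : ℕ) := by positivity
  rw [hdenom] at hspf
  have hle := hS.two_le_two_mul_sub_one_mul_spf hsync ht1 ht
  rw [hspf, ← mul_div_assoc, le_div_iff₀ hpos] at hle
  have hle' : n + (n - #A) + 1 ≤ 2 * n := by
    exact_mod_cast (by linarith : (n + (n - #A : ℕ) + 1 : ℝ) ≤ 2 * n)
  exact ⟨n - #A, by omega, hspf⟩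

theorem IsAutomaton.span_feasible_le_tightSpace (hS : IsAutomaton S)
    (ht : t < tripleRendezvousTime S) {A : Finset (Fin n)} {g : Fin n → Fin n}
    (h : IsDoubleCoverMatching (mergeGraph S t) A g) {c : ℝ} (hc : (2 * n - #A) * c = 2) :
    Submodule.span ℝ (feasible S t c) ≤ tightSpace A g c := by
  rw [hS.feasible_eq_cappedDistributions ht]
  exact Submodule.span_le.2 fun p hp => h.mem_tightSpace hp (by rwa [Fintype.card_fin])

theorem IsAutomaton.length_le_of_spf_eq (hn : 3 ≤ n) (hS : IsAutomaton S)
    (hsync : IsSynchronizing S) {s m : ℕ} (ht : t < tripleRendezvousTime S)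
    (h : ∀ j < m, spf S (t + j) = 2 / ((n : ℝ) + s)) : m ≤ (n - s) / 2 + 1 := by
  have : Nonempty (Fin n) := ⟨0, by omega⟩
  rcases m.eq_zero_or_pos with rfl | hm
  · exact Nat.zero_le _
  obtain ⟨A, g, hAg, hspf⟩ := hS.exists_isDoubleCoverMatching_spf_eq ht
  have hn' : (3 : ℝ) ≤ n := mod_cast hn
  have hs : (0 : ℝ) ≤ s := s.cast_nonneg
  have hdenom : (2 * n - #A : ℝ) = n + s := by
    rw [show spf S t = _ from h 0 hm] at hspf
    simpa [div_eq_mul_inv] using hspf.symm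
  have hA : #A = n - s := by
    have : #A + s = n := by exact_mod_cast (by linarith : (#A + s : ℝ) = n)
    omega
  have hc1 : 2 / ((n : ℝ) + s) ≠ 1 := ((div_lt_one (by linarith)).2 (by linarith)).ne
  have hle : Submodule.span ℝ (feasible S t (2 / (n + s))) ≤ tightSpace A g (2 / ((n : ℝ) + s)) :=
    hS.span_feasible_le_tightSpace ht hAg (hdenom ▸ mul_div_cancel₀ _ (by linarith))
  calc m ≤ finrank ℝ (Submodule.span ℝ (feasible S t (2 / (n + s)))) :=
        hS.le_finrank_span_feasible hsync (fun j hj => h j hj ▸ (hS.isLeast_spf (t + j)).1)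
          fun k hk => hAg.single_notMem_tightSpace hc1 k (hle hk)
    _ ≤ finrank ℝ (tightSpace A g (2 / ((n : ℝ) + s))) := Submodule.finrank_mono hle
    _ ≤ (n - s) / 2 + 1 := hA ▸ finrank_tightSpace_le hAg.injOn _

end SpfValues

end SyncAutomaton

theorem mainTheorem2 (n : ℕ) (hn : 3 ≤ n) (S : Set (Matrix (Fin n) (Fin n) ℝ))
    (hS : SyncAutomaton.IsAutomaton S) (hsync : SyncAutomaton.IsSynchronizing S) :
    (∀ t : ℕ, 1 ≤ t → t < SyncAutomaton.tripleRendezvousTime S →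
      ∃ s : ℕ, s ≤ n - 1 ∧ SyncAutomaton.spf S t = 2 / ((n : ℝ) + (s : ℝ))) ∧
    (∀ s : ℕ, s ≤ n - 1 → ∀ t m : ℕ, t < SyncAutomaton.tripleRendezvousTime S →
      (∀ j : ℕ, j < m → SyncAutomaton.spf S (t + j) = 2 / ((n : ℝ) + (s : ℝ))) →
      m ≤ (n - s) / 2 + 1) := by
  have : Nontrivial (Fin n) := Fin.nontrivial_iff_two_le.2 (by omega)
  exact ⟨fun t ht1 ht => hS.exists_spf_eq hsync ht1 ht,
    fun s _ t m ht h => hS.length_le_of_spf_eq hn hsync ht h⟩
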